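/- Let $k$ be a field and let $\mathscr C$ be a finite category (finitely many objects and morphisms) that is skeletal (distinct objects are not isomorphic) and EI (every endomorphism is an isomorphism). Assume that $\mathscr C$ is projective over $k$: for all objects $x,y$ the $k\mathrm{Aut}(y)$-$k\mathrm{Aut}(x)$-bimodule $k\mathrm{Hom}_{\mathscr C}(x,y)$ is projective as a left $k\mathrm{Aut}(y)$-module and as a right $k\mathrm{Aut}(x)$-module. Let $k\mathscr C$ be the category algebra, that is, the $k$-vector space with basis all morphisms of $\mathscr C$, where the product of $\alpha$ and $\beta$ is $\alpha\circ\beta$ if they can be composed and $0$ otherwise. A functor $M$ from $\mathscr C$ to finite dimensional $k$-vector spaces is identified with the left $k\mathscr C$-module $\bigoplus_x M(x)$. Let $K$ be the functor such that $K(x)$ has as basis all morphisms $\gamma\colon w\to x$ with $w\neq x$, and $K(\alpha)(\gamma)=\alpha\circ\gamma$ for each morphism $\alpha\colon x\to y$. A morphism $\alpha$ is unfactorizable if it is not an isomorphism and $\alpha=\gamma\circ\beta$ implies that $\beta$ or $\gamma$ is an isomorphism. The category $\mathscr C$ is free if it has the Unique Factorization Property: whenever a non-isomorphism $\alpha\colon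 x\to y$ has two decompositions $x=x_0\xrightarrow{\alpha_1}x_1\to\cdots\xrightarrow{\alpha_m}x_m=y$ and $x=y_0\xrightarrow{\beta_1}y_1\to\cdots\xrightarrow{\beta_n}y_n=y$ into unfactorizable morphisms, then $m=n$, $x_i=y_i$ for all $i$, and there are $h_i\in\mathrm{Aut}(x_i)$ for $0\le i\le n$, with $h_0=1$ and $h_n=1$, such that $\beta_i=h_i\circ\alpha_i\circ h_{i-1}^{-1}$ for $1\le i\le n$. Then $K$, viewed as a $k\mathscr C$-module, is projective if and only if $\mathscr C$ is free. -/

import Mathlib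

open CategoryTheory

universe w v u t

namespace FinEI

noncomputable section

/-! ### EI categories and freeness -/

/-- The EI condition: every endomorphism is an isomorphism. -/
def IsEI (C : Type u) [Category.{v} C] : Prop :=
  ∀ (x : C) (f : x ⟶ x), IsIso f

/-- A morphism is unfactorizable if it is a non-isomorphism and, in each factorization of it into
two morphisms, one of the factors is an isomorphism. -/
def Unfactorizable {C : Type u} [Category.{v} C] {x y : C} (α : x ⟶ y) : Prop :=
  ¬ IsIso α ∧ ∀ (z : C) (β : x ⟶ z) (γ : z ⟶ y), β ≫ γ = α → IsIso β ∨ IsIso γ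

/-- Finite non-empty chains `x = x₀ ⟶ x₁ ⟶ ⋯ ⟶ xₙ = y` of unfactorizable morphisms. -/
inductive Chain {C : Type u} [Category.{v} C] : C → C → Type (max u v)
  | single {x y : C} (α : x ⟶ y) (hα : Unfactorizable α) : Chain x y
  | cons {x z y : C} (α : x ⟶ z) (hα : Unfactorizable α) (p : Chain z y) : Chain x y

/-- The composite of a chain. -/
def Chain.comp {C : Type u} [Category.{v} C] : {x y : C} → Chain x y → (x ⟶ y)
  | _, _, .single α _ => α
  | _, _, .cons α _ p => α ≫ p.comp

/-- For `h₀` in `Aut x₀`, the relation `Chain.Twist h₀ (α₁, …, αₘ) (β₁, …, βₙ)` says that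
`m = n`, that the two chains run through the same objects `x₀, x₁, …, xₙ`, and that there are
`hᵢ` in `Aut xᵢ` for `1 ≤ i ≤ n - 1` with `βᵢ = hᵢ ∘ αᵢ ∘ hᵢ₋₁⁻¹` for `1 ≤ i ≤ n - 1` and
`βₙ = αₙ ∘ hₙ₋₁⁻¹`. -/
inductive Chain.Twist {C : Type u} [Category.{v} C] :
    {x y : C} → Aut x → Chain x y → Chain x y → Prop
  | single {x y : C} (h : Aut x) (α β : x ⟶ y) (hα : Unfactorizable α) (hβ : Unfactorizable β)
      (e : β = h.inv ≫ α) : Chain.Twist h (.single α hα) (.single β hβ)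
  | cons {x z y : C} (h : Aut x) (h' : Aut z) (α β : x ⟶ z)
      (hα : Unfactorizable α) (hβ : Unfactorizable β) (p q : Chain z y)
      (e : β = h.inv ≫ α ≫ h'.hom) (r : Chain.Twist h' p q) :
      Chain.Twist h (.cons α hα p) (.cons β hβ q)

/-- Freeness of a finite EI category, i.e. the Unique Factorization Property: any two
decompositions of a non-isomorphism into unfactorizable morphisms have the same length and the
same intermediate objects, and differ by automorphisms of the intermediate objects (with
`h₀ = 1`, so that `β₁ = h₁ ∘ α₁`). -/
def IsFree (C : Type u) [Category.{v} C] : Prop :=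
  ∀ (x y : C) (α : x ⟶ y), ¬ IsIso α →
    ∀ p q : Chain x y, p.comp = α → q.comp = α → Chain.Twist 1 p q

/-! ### Projectivity over `k` -/

/-- The left action of `Aut y` on `k Hom(x, y)`, with `g • α = g ∘ α`. -/
def leftRep (k : Type w) [Field k] {C : Type u} [Category.{v} C] (x y : C) :
    Representation k (Aut y) ((x ⟶ y) →₀ k) where
  toFun g := Finsupp.lmapDomain k k (fun α : x ⟶ y => α ≫ g.hom)
  map_one' := by
    refine Finsupp.lhom_ext fun α r => ?_
    simp [show (1 : Aut y) = Iso.refl y from rfl]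
  map_mul' g h := by
    refine Finsupp.lhom_ext fun α r => ?_
    simp [show (g * h).hom = h.hom ≫ g.hom from rfl]

/-- The right action of `Aut x` on `k Hom(x, y)`, with `α • g = α ∘ g`, as a left action of the
opposite group. Thus a right `k Aut(x)`-module is seen as a left module over
`k[(Aut x)ᵒᵖ] = (k Aut(x))ᵒᵖ`. -/
def rightRep (k : Type w) [Field k] {C : Type u} [Category.{v} C] (x y : C) :
    Representation k (Aut x)ᵐᵒᵖ ((x ⟶ y) →₀ k) where
  toFun g := Finsupp.lmapDomain k k (fun α : x ⟶ y => g.unop.hom ≫ α)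
  map_one' := by
    refine Finsupp.lhom_ext fun α r => ?_
    simp [show (1 : Aut x) = Iso.refl x from rfl]
  map_mul' g h := by
    refine Finsupp.lhom_ext fun α r => ?_
    simp [show (h.unop * g.unop).hom = g.unop.hom ≫ h.unop.hom from rfl]

/-- `C` is projective over `k`: each bimodule `k Hom(x, y)` is projective as a left
`k Aut(y)`-module and as a right `k Aut(x)`-module. -/
def IsProjectiveOver (k : Type w) [Field k] (C : Type u) [Category.{v} C] : Prop :=
  ∀ x y : C,
    Module.Projective (MonoidAlgebra k (Aut y)) (leftRep k x y).asModule ∧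
    Module.Projective (MonoidAlgebra k (Aut x)ᵐᵒᵖ) (rightRep k x y).asModule

/-! ### The category algebra -/

/-- The set of all morphisms of `C`. -/
structure Mor (C : Type u) [Category.{v} C] where
  {src : C}
  {tgt : C}
  hom : src ⟶ tgt

/-- The underlying space of the category algebra: the `k`-vector space with basis `Mor C`. -/
def CategoryAlgebra (k : Type w) [Field k] (C : Type u) [Category.{v} C] : Type (max u v w) :=
  Mor C →₀ k

namespace CategoryAlgebra

variable (k : Type w) [Field k] (C : Type u) [Category.{v} C]

instance : AddCommGroup (CategoryAlgebra k C) := inferInstanceAs (AddCommGroup (Mor C →₀ k))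

instance : Module k (CategoryAlgebra k C) := inferInstanceAs (Module k (Mor C →₀ k))

variable {C}

/-- The basis element of the category algebra given by a morphism. -/
def of {x y : C} (α : x ⟶ y) : CategoryAlgebra k C :=
  (Finsupp.single ⟨α⟩ 1 : Mor C →₀ k)

open Classical in
/-- The product of two basis elements: `α * β = α ∘ β` if `α` and `β` can be composed, and `0`
otherwise. -/
def basisMul (a b : Mor C) : CategoryAlgebra k C :=
  if h : b.tgt = a.src then of k (b.hom ≫ eqToHom h ≫ a.hom) else 0

variable (C)

/-- The product of the category algebra, extended bilinearly from the basis. -/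
def mulLin : CategoryAlgebra k C →ₗ[k] CategoryAlgebra k C →ₗ[k] CategoryAlgebra k C :=
  Finsupp.linearCombination k fun a : Mor C =>
    (Finsupp.linearCombination k (fun b : Mor C => basisMul k a b) :
      (Mor C →₀ k) →ₗ[k] CategoryAlgebra k C)

instance : Mul (CategoryAlgebra k C) := ⟨fun a b => mulLin k C a b⟩

/-- The unit of the category algebra is the sum of the identities of all objects. -/
instance [Fintype C] : One (CategoryAlgebra k C) := ⟨∑ x : C, of k (𝟙 x)⟩

variable {k C}

theorem mul_def (a b : CategoryAlgebra k C) : a * b = mulLin k C a b := rfl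

theorem one_def [Fintype C] : (1 : CategoryAlgebra k C) = ∑ x : C, of k (𝟙 x) := rfl

/-- Linear maps out of the category algebra agree if they agree on morphisms. -/
theorem hom_ext {V : Type*} [AddCommMonoid V] [Module k V]
    {f g : CategoryAlgebra k C →ₗ[k] V}
    (h : ∀ (x y : C) (α : x ⟶ y), f (of k α) = g (of k α)) : f = g :=
  Finsupp.lhom_ext' (R := k) (α := Mor C) (M := k) fun a => LinearMap.ext_ring (h _ _ a.hom)

theorem of_mul_of' {x y x' y' : C} (α : x ⟶ y) (β : x' ⟶ y') :
    of k α * of k β = basisMul k ⟨α⟩ ⟨β⟩ := by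
  rw [mul_def, mulLin, of, of]
  erw [Finsupp.linearCombination_single, one_smul, Finsupp.linearCombination_single, one_smul]

theorem of_mul_of {x y z : C} (α : y ⟶ z) (β : x ⟶ y) :
    of k α * of k β = of k (β ≫ α) := by
  rw [of_mul_of', basisMul, dif_pos rfl]
  simp

theorem of_mul_of_ne {x y x' y' : C} (α : x ⟶ y) (β : x' ⟶ y') (h : y' ≠ x) :
    of k α * of k β = 0 := by
  rw [of_mul_of', basisMul, dif_neg h]

theorem mul_assoc' (a b c : CategoryAlgebra k C) : a * b * c = a * (b * c) := by
  have key : (mulLin k C).compr₂ (mulLin k C) =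
      (LinearMap.llcomp k (CategoryAlgebra k C) (CategoryAlgebra k C)
        (CategoryAlgebra k C)).compl₁₂ (mulLin k C) (mulLin k C) := by
    refine hom_ext fun x y α => hom_ext fun x' y' β => hom_ext fun x'' y'' γ => ?_
    change of k α * of k β * of k γ = of k α * (of k β * of k γ)
    by_cases h : y' = x
    · subst h
      rw [of_mul_of]
      by_cases h' : y'' = x'
      · subst h'
        rw [of_mul_of, of_mul_of, of_mul_of, Category.assoc]
      · rw [of_mul_of_ne _ _ h', of_mul_of_ne _ _ h', mul_def _ 0, map_zero]
    · rw [of_mul_of_ne _ _ h, mul_def 0, map_zero, LinearMap.zero_apply]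
      by_cases h' : y'' = x'
      · subst h'
        rw [of_mul_of, of_mul_of_ne _ _ h]
      · rw [of_mul_of_ne _ _ h', mul_def _ 0, map_zero]
  exact LinearMap.congr_fun (LinearMap.congr_fun (LinearMap.congr_fun key a) b) c

theorem one_mul' [Fintype C] (a : CategoryAlgebra k C) : 1 * a = a := by
  have key : mulLin k C 1 = LinearMap.id := by
    refine hom_ext fun x y α => ?_
    rw [one_def, map_sum, LinearMap.sum_apply]
    refine (Finset.sum_eq_single y (fun z _ hz => ?_) (fun h => absurd (Finset.mem_univ y) h)).trans
      ?_
    · change of k (𝟙 z) * of k α = 0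
      exact of_mul_of_ne _ _ (Ne.symm hz)
    · change of k (𝟙 y) * of k α = _
      rw [of_mul_of, Category.comp_id, LinearMap.id_apply]
  exact LinearMap.congr_fun key a

theorem mul_one' [Fintype C] (a : CategoryAlgebra k C) : a * 1 = a := by
  have key : (mulLin k C).flip 1 = LinearMap.id := by
    refine hom_ext fun x y α => ?_
    rw [LinearMap.flip_apply, one_def, map_sum]
    refine (Finset.sum_eq_single x (fun z _ hz => ?_) (fun h => absurd (Finset.mem_univ x) h)).trans
      ?_
    · change of k α * of k (𝟙 z) = 0
      exact of_mul_of_ne _ _ hz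
    · change of k α * of k (𝟙 x) = _
      rw [of_mul_of, Category.id_comp, LinearMap.id_apply]
  exact LinearMap.congr_fun key a

/-- The category algebra is a ring (with unit, as `C` has finitely many objects). -/
instance [Fintype C] : Ring (CategoryAlgebra k C) where
  __ := (inferInstance : AddCommGroup (CategoryAlgebra k C))
  mul a b := a * b
  one := 1
  mul_assoc := mul_assoc'
  one_mul := one_mul'
  mul_one := mul_one'
  left_distrib a b c := map_add (mulLin k C a) b c
  right_distrib a b c := by
    change mulLin k C (a + b) c = mulLin k C a c + mulLin k C b c
    rw [map_add, LinearMap.add_apply]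
  zero_mul a := by
    change mulLin k C 0 a = 0
    rw [map_zero, LinearMap.zero_apply]
  mul_zero a := map_zero (mulLin k C a)

instance [Fintype C] : Algebra k (CategoryAlgebra k C) :=
  Algebra.ofModule
    (fun r a b => by
      change mulLin k C (r • a) b = r • mulLin k C a b
      rw [map_smul, LinearMap.smul_apply])
    (fun r a b => map_smul (mulLin k C a) r b)

end CategoryAlgebra

/-! ### Functors as modules over the category algebra -/

/-- The underlying space `⨁ₓ M(x)` of the module over the category algebra that corresponds to a
functor `M` from `C` to `k`-vector spaces (a product, as `C` has finitely many objects). -/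
def FunctorModule {k : Type w} [Field k] {C : Type u} [Category.{v} C]
    (M : C ⥤ ModuleCat.{t} k) : Type (max u t) :=
  ∀ x : C, M.obj x

namespace FunctorModule

variable {k : Type w} [Field k] {C : Type u} [Category.{v} C] (M : C ⥤ ModuleCat.{t} k)

instance : AddCommGroup (FunctorModule M) := inferInstanceAs (AddCommGroup (∀ x : C, M.obj x))

instance : Module k (FunctorModule M) := inferInstanceAs (Module k (∀ x : C, M.obj x))

open Classical in
/-- A morphism `α : x ⟶ y` acts on `⨁ M` by applying `M(α)` to the component at `x`; the result
lies in the component at `y`. -/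
def actMor (a : Mor C) : Module.End k (FunctorModule M) :=
  (LinearMap.single k (fun x : C => M.obj x) a.tgt) ∘ₗ (M.map a.hom).hom ∘ₗ
    (LinearMap.proj a.src : (∀ x : C, M.obj x) →ₗ[k] M.obj a.src)

/-- The action of the category algebra, extended linearly from the basis. -/
def actLin : CategoryAlgebra k C →ₗ[k] Module.End k (FunctorModule M) :=
  Finsupp.linearCombination k (actMor M)

theorem actLin_of {x y : C} (α : x ⟶ y) : actLin M (CategoryAlgebra.of k α) = actMor M ⟨α⟩ := by
  rw [actLin, CategoryAlgebra.of]
  erw [Finsupp.linearCombination_single, one_smul]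

open Classical in
theorem actMor_apply {x y : C} (α : x ⟶ y) (m : ∀ x : C, M.obj x) :
    (actMor M ⟨α⟩ : Module.End k (∀ x : C, M.obj x)) m = Pi.single y ((M.map α).hom (m x)) := rfl

theorem actLin_one [Fintype C] : actLin M 1 = 1 := by
  classical
  refine LinearMap.ext fun m => ?_
  rw [CategoryAlgebra.one_def, map_sum, LinearMap.sum_apply]
  refine Eq.trans (Finset.sum_congr rfl fun x _ => ?_)
    (Finset.univ_sum_single (M := fun x : C => M.obj x) m)
  rw [actLin_of]
  refine (actMor_apply M (𝟙 x) m).trans ?_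
  rw [CategoryTheory.Functor.map_id, ModuleCat.hom_id, LinearMap.id_apply]

theorem actLin_mul (a b : CategoryAlgebra k C) :
    actLin M (a * b) = actLin M a * actLin M b := by
  classical
  have key : (CategoryAlgebra.mulLin k C).compr₂ (actLin M) =
      (LinearMap.mul k (Module.End k (FunctorModule M))).compl₁₂ (actLin M) (actLin M) := by
    refine CategoryAlgebra.hom_ext fun x y α => CategoryAlgebra.hom_ext fun x' y' β => ?_
    change actLin M (CategoryAlgebra.of k α * CategoryAlgebra.of k β) =
      actLin M (CategoryAlgebra.of k α) * actLin M (CategoryAlgebra.of k β)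
    refine LinearMap.ext fun (m : ∀ x : C, M.obj x) => ?_
    by_cases h : y' = x
    · subst h
      rw [CategoryAlgebra.of_mul_of, actLin_of, actLin_of, actLin_of]
      change (Pi.single y ((M.map (β ≫ α)).hom (m x')) : ∀ x : C, M.obj x) =
        Pi.single y ((M.map α).hom
          ((Pi.single y' ((M.map β).hom (m x')) : ∀ x : C, M.obj x) y'))
      rw [Pi.single_eq_same, CategoryTheory.Functor.map_comp, ModuleCat.hom_comp,
        LinearMap.comp_apply]
    · rw [CategoryAlgebra.of_mul_of_ne _ _ h, actLin_of, actLin_of, map_zero]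
      change (0 : ∀ x : C, M.obj x) = Pi.single y ((M.map α).hom
          ((Pi.single y' ((M.map β).hom (m x')) : ∀ x : C, M.obj x) x))
      rw [Pi.single_eq_of_ne (Ne.symm h), map_zero, Pi.single_zero]
  exact LinearMap.congr_fun (LinearMap.congr_fun key a) b

/-- The module over the category algebra that corresponds to the functor `M`. -/
instance [Fintype C] : Module (CategoryAlgebra k C) (FunctorModule M) where
  smul a m := actLin M a m
  one_smul m := by
    change actLin M 1 m = m
    rw [actLin_one, Module.End.one_apply]
  mul_smul a b m := by
    change actLin M (a * b) m = actLin M a (actLin M b m)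
    rw [actLin_mul, Module.End.mul_apply]
  smul_zero a := map_zero (actLin M a)
  smul_add a := map_add (actLin M a)
  add_smul a b m := by
    change actLin M (a + b) m = actLin M a m + actLin M b m
    rw [map_add, LinearMap.add_apply]
  zero_smul m := by
    change actLin M 0 m = 0
    rw [map_zero, LinearMap.zero_apply]

end FunctorModule

/-! ### The functor `K` -/

/-- The basis of `K(x)`: all morphisms `w ⟶ x` with `w ≠ x`. -/
structure KBasis {C : Type u} [Category.{v} C] (x : C) where
  src : C
  ne : src ≠ x
  hom : src ⟶ x

/-- In a skeletal EI category, a morphism `γ : w ⟶ x` with `w ≠ x` followed by `α : x ⟶ y` is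
again a morphism between distinct objects. -/
theorem ne_of_comp {C : Type u} [Category.{v} C] (hEI : IsEI C) (hsk : Skeletal C) {w x y : C}
    (hne : w ≠ x) (γ : w ⟶ x) (α : x ⟶ y) : w ≠ y := by
  rintro rfl
  have h₁ : IsIso (γ ≫ α) := hEI _ _
  have h₂ : IsIso (α ≫ γ) := hEI _ _
  have h₃ : IsSplitMono γ := ⟨⟨⟨α ≫ inv (γ ≫ α), by rw [← Category.assoc, IsIso.hom_inv_id]⟩⟩⟩
  have h₄ : Epi γ := by
    have : Epi (α ≫ γ) := inferInstance
    exact epi_of_epi α γ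
  have h₅ : IsIso γ := isIso_of_epi_of_isSplitMono γ
  exact hne (hsk ⟨asIso γ⟩)

/-- Composition with `α : x ⟶ y` on basis elements, `γ ↦ α ∘ γ`. -/
def KBasis.comp {C : Type u} [Category.{v} C] (hEI : IsEI C) (hsk : Skeletal C) {x y : C}
    (α : x ⟶ y) (γ : KBasis x) : KBasis y :=
  ⟨γ.src, ne_of_comp hEI hsk γ.ne γ.hom α, γ.hom ≫ α⟩

/-- The functor `K` : `K(x)` is the `k`-vector space with basis all morphisms `γ : w ⟶ x` with
`w ≠ x`, and `K(α)(γ) = α ∘ γ`. -/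
def functorK (k : Type w) [Field k] {C : Type u} [Category.{v} C] (hEI : IsEI C)
    (hsk : Skeletal C) : C ⥤ ModuleCat.{max u v w} k where
  obj x := ModuleCat.of k (KBasis x →₀ k)
  map α := ModuleCat.ofHom (Finsupp.lmapDomain k k (KBasis.comp hEI hsk α))
  map_id x := by
    have h : KBasis.comp hEI hsk (𝟙 x) = id := by
      funext γ
      simp [KBasis.comp]
    rw [h, Finsupp.lmapDomain_id]
    rfl
  map_comp {x y z} α β := by
    have h : KBasis.comp hEI hsk (α ≫ β) = KBasis.comp hEI hsk β ∘ KBasis.comp hEI hsk α := by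
      funext γ
      simp [KBasis.comp]
    rw [h, Finsupp.lmapDomain_comp]
    rfl

end

end FinEI

/-! Freeness is replaced by `UniqueFirstFactor`: if `α ∘ β = α' ∘ β'` with `β`, `β'` unfactorizable,
then the two factorizations differ by an isomorphism of the intermediate objects. By
`isFree_iff_uniqueFirstFactor`, the full property follows by peeling off first factors. Inductions
run along the order `Precedes`, well-founded because there are finitely many objects.

If first factors are unique, each basis element `γ` of `K` is `α ∘ β` with `β` in a fixed set of
representatives, and `α` is unique up to the stabilizer of `β` in the automorphism group of its
target. Projectivity over `k` makes the order of this stabilizer invertible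
(`natCard_ne_zero_of_projective`), so its averaging idempotent `e` exists. Then `α * e` depends only
on `γ`, and sending `γ` to `α * e` at the coordinate `β` splits the canonical map from the free
module on the elements of `K` onto `K` (`projective_functorK`).

Conversely, let `L` have as basis the pairs `(β, α)` modulo isomorphisms of the intermediate object.
Composition gives a surjection from `L` to `K`, which splits if `K` is projective.
`section_map_composition_basisL` shows that any section is a two-sided inverse, so composition is
injective on basis classes, which is uniqueness of first factors. -/

namespace FinEI

/-! ### Factorizations, and freeness as uniqueness of the first factor -/

section Combinatorics

variable {C : Type u} [Category.{v} C]

theorem isIso_iff_eq (hEI : IsEI C) (hsk : Skeletal C) {x y : C} (f : x ⟶ y) :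
    IsIso f ↔ x = y := by
  constructor
  · intro h
    exact hsk ⟨asIso f⟩
  · rintro rfl
    exact hEI _ f

/-- The strict order on objects: `x` precedes `y` if they differ and there is a morphism from `x`
to `y`. -/
def Precedes (x y : C) : Prop := x ≠ y ∧ Nonempty (x ⟶ y)

theorem Precedes.of_not_isIso (hEI : IsEI C) (hsk : Skeletal C) {x y : C} {f : x ⟶ y}
    (hf : ¬ IsIso f) : Precedes x y :=
  ⟨fun h => hf ((isIso_iff_eq hEI hsk f).2 h), ⟨f⟩⟩

theorem Precedes.trans (hEI : IsEI C) (hsk : Skeletal C) {x y z : C} (h : Precedes x y)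
    (h' : Precedes y z) : Precedes x z := by
  obtain ⟨hne, ⟨f⟩⟩ := h
  obtain ⟨-, ⟨g⟩⟩ := h'
  exact ⟨ne_of_comp hEI hsk hne f g, ⟨f ≫ g⟩⟩

theorem wellFounded_precedes [Finite C] (hEI : IsEI C) (hsk : Skeletal C) :
    WellFounded (Precedes (C := C)) := by
  have : IsTrans C Precedes := ⟨fun _ _ _ h h' => h.trans hEI hsk h'⟩
  have : Std.Irrefl (Precedes (C := C)) := ⟨fun _ h => h.1 rfl⟩
  exact Finite.wellFounded_of_trans_of_irrefl _

theorem wellFounded_precedes_swap [Finite C] (hEI : IsEI C) (hsk : Skeletal C) :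
    WellFounded (Function.swap (Precedes (C := C))) := by
  have : IsTrans C (Function.swap Precedes) := ⟨fun _ _ _ h h' => h'.trans hEI hsk h⟩
  have : Std.Irrefl (Function.swap (Precedes (C := C))) := ⟨fun _ h => h.1 rfl⟩
  exact Finite.wellFounded_of_trans_of_irrefl _

theorem not_isIso_comp (hEI : IsEI C) (hsk : Skeletal C) {x y z : C} {f : x ⟶ y}
    (hf : ¬ IsIso f) (g : y ⟶ z) : ¬ IsIso (f ≫ g) := by
  rw [isIso_iff_eq hEI hsk] at hf ⊢
  exact ne_of_comp hEI hsk hf f g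

theorem Unfactorizable.comp_iso {x y z : C} {β : x ⟶ y} (hβ : Unfactorizable β) (i : y ⟶ z)
    [IsIso i] : Unfactorizable (β ≫ i) := by
  refine ⟨fun h => hβ.1 (IsIso.of_isIso_comp_right β i), fun t f g hfg => ?_⟩
  rcases hβ.2 t f (g ≫ inv i) (by rw [← Category.assoc, hfg]; simp) with h | h
  · exact Or.inl h
  · exact Or.inr (IsIso.of_isIso_comp_right g (inv i))

theorem Unfactorizable.iso_comp {x y z : C} {β : y ⟶ z} (hβ : Unfactorizable β) (i : x ⟶ y)
    [IsIso i] : Unfactorizable (i ≫ β) := by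
  refine ⟨fun h => hβ.1 (IsIso.of_isIso_comp_left i β), fun t f g hfg => ?_⟩
  rcases hβ.2 t (inv i ≫ f) g (by rw [Category.assoc, hfg]; simp) with h | h
  · exact Or.inl (IsIso.of_isIso_comp_left (inv i) f)
  · exact Or.inr h

theorem Unfactorizable.aut_inv_comp {y z : C} {β : y ⟶ z} (hβ : Unfactorizable β) (h : Aut y) :
    Unfactorizable (h.inv ≫ β) :=
  have : IsIso h.inv := Iso.isIso_inv h
  hβ.iso_comp h.inv

/-- In a finite skeletal EI category, each non-isomorphism has an unfactorizable first factor. -/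
theorem exists_unfactorizable_comp [Finite C] (hEI : IsEI C) (hsk : Skeletal C) {y : C} :
    ∀ {x : C} (γ : x ⟶ y), ¬ IsIso γ →
      ∃ (z : C) (β : x ⟶ z) (α : z ⟶ y), Unfactorizable β ∧ β ≫ α = γ := by
  -- The induction is on the target: in a factorization into two non-isomorphisms, the first factor
  -- ends at an object preceding `y`.
  induction y using (wellFounded_precedes hEI hsk).induction with
  | _ y ih =>
    intro x γ hγ
    by_cases h : Unfactorizable γ
    · exact ⟨y, γ, 𝟙 y, h, Category.comp_id γ⟩
    · simp only [Unfactorizable, hγ, not_false_eq_true, true_and, not_forall, not_or] at h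
      obtain ⟨z, f, g, rfl, hf, hg⟩ := h
      obtain ⟨t, β, α, hβ, rfl⟩ := ih z (.of_not_isIso hEI hsk hg) f hf
      exact ⟨t, β, α ≫ g, hβ, (Category.assoc _ _ _).symm⟩

theorem exists_chain [Finite C] (hEI : IsEI C) (hsk : Skeletal C) {x : C} :
    ∀ {y : C} (γ : x ⟶ y), ¬ IsIso γ → ∃ p : Chain x y, p.comp = γ := by
  induction x using (wellFounded_precedes_swap hEI hsk).induction with
  | _ x ih =>
    intro y γ hγ
    obtain ⟨z, β, α, hβ, rfl⟩ := exists_unfactorizable_comp hEI hsk γ hγ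
    by_cases hα : IsIso α
    · exact ⟨.single _ (hβ.comp_iso α), rfl⟩
    · obtain ⟨p, rfl⟩ := ih z (.of_not_isIso hEI hsk hβ.1) α hα
      exact ⟨.cons β hβ p, rfl⟩

theorem Chain.not_isIso_comp (hEI : IsEI C) (hsk : Skeletal C) {x y : C} (p : Chain x y) :
    ¬ IsIso p.comp := by
  cases p with
  | single α hα => exact hα.1
  | cons α hα p => exact FinEI.not_isIso_comp hEI hsk hα.1 _

theorem Chain.Twist.comp_eq {x y : C} {h : Aut x} {p q : Chain x y} (r : Chain.Twist h p q) :
    q.comp = h.inv ≫ p.comp := by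
  induction r with
  | single h α β hα hβ e => exact e
  | cons h h' α β hα hβ p q e r ih =>
    simp only [Chain.comp, ih, e, Category.assoc]
    exact congrArg (fun f => h.inv ≫ α ≫ f) (Iso.hom_inv_id_assoc (h' : _ ≅ _) p.comp)

variable (C) in
/-- Unfactorizable first factors are unique up to an automorphism of the intermediate object. -/
def UniqueFirstFactor : Prop :=
  ∀ ⦃w x x' y : C⦄ (β : w ⟶ x) (β' : w ⟶ x') (α : x ⟶ y) (α' : x' ⟶ y),
    Unfactorizable β → Unfactorizable β' → β ≫ α = β' ≫ α' →
      ∃ i : x ≅ x', β' = β ≫ i.hom ∧ α = i.hom ≫ α'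

theorem IsFree.uniqueFirstFactor [Finite C] (hEI : IsEI C) (hsk : Skeletal C) (hfree : IsFree C) :
    UniqueFirstFactor C := by
  intro w x x' y β β' α α' hβ hβ' e
  -- Chains are non-empty and consist of non-isomorphisms, so an invertible `α` is treated apart:
  -- the composite is then itself unfactorizable, which forces `α'` to be invertible too.
  by_cases hα : IsIso α
  · have hα' : IsIso α' :=
      ((hβ.comp_iso α).2 x' β' α' e.symm).resolve_left hβ'.1
    refine ⟨asIso α ≪≫ (asIso α').symm, ?_, by simp⟩
    simp [← Category.assoc, e]
  · have hα' : ¬ IsIso α' := fun hα' =>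
      hα (((hβ'.comp_iso α').2 x β α e).resolve_left hβ.1)
    obtain ⟨p, rfl⟩ := exists_chain hEI hsk α hα
    obtain ⟨q, rfl⟩ := exists_chain hEI hsk α' hα'
    -- The first twisting automorphism of the two extended chains is the isomorphism sought; the
    -- twist of the tails gives the second equation.
    have r := hfree w y _ (not_isIso_comp hEI hsk hβ.1 p.comp) (.cons β hβ p) (.cons β' hβ' q)
      rfl e.symm
    cases r with
    | cons _ h' _ _ _ _ _ _ e' r =>
      refine ⟨h', ?_, ?_⟩
      · rw [e']
        exact Category.id_comp _
      · rw [r.comp_eq]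
        exact (Iso.hom_inv_id_assoc (h' : _ ≅ _) p.comp).symm

/-- The initial automorphism `h` is arbitrary so that the induction closes: once first factors are
matched, the composites of the tails agree only up to the automorphism found there. Lengths agree
because an unfactorizable morphism is not a composite of two non-isomorphisms. -/
theorem Chain.twist_of_comp_eq (hEI : IsEI C) (hsk : Skeletal C) (hC : UniqueFirstFactor C)
    {x y : C} (p : Chain x y) : ∀ (q : Chain x y) (h : Aut x), q.comp = h.inv ≫ p.comp →
      Chain.Twist h p q := by
  induction p with
  | single α hα =>
    intro q h e
    cases q with
    | single β hβ => exact .single h α β hα hβ e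
    | cons β hβ q =>
      exact (((hα.aut_inv_comp h).2 _ β q.comp e).elim hβ.1
        (q.not_isIso_comp hEI hsk)).elim
  | cons α hα p ih =>
    intro q h e
    cases q with
    | single β hβ =>
      refine ((hβ.2 _ (h.inv ≫ α) p.comp ?_).elim (hα.aut_inv_comp h).1
        (p.not_isIso_comp hEI hsk)).elim
      rw [Category.assoc]
      exact e.symm
    | cons β hβ q =>
      obtain ⟨i, hi, hi'⟩ := hC (h.inv ≫ α) β p.comp q.comp (hα.aut_inv_comp h) hβ (by
        rw [Category.assoc]
        exact e.symm)
      -- Skeletality turns the isomorphism `i` into an automorphism, as `Chain.Twist` requires.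
      obtain rfl := hsk ⟨i⟩
      refine .cons h i α β hα hβ p q (by rw [hi, Category.assoc]) (ih q i ?_)
      rw [hi', Iso.inv_hom_id_assoc]

theorem isFree_iff_uniqueFirstFactor [Finite C] (hEI : IsEI C) (hsk : Skeletal C) :
    IsFree C ↔ UniqueFirstFactor C := by
  refine ⟨fun h => h.uniqueFirstFactor hEI hsk, fun h x y α _ p q hp hq => ?_⟩
  refine p.twist_of_comp_eq hEI hsk h q 1 ?_
  rw [hp, hq]
  exact (Category.id_comp α).symm

end Combinatorics

/-! ### Projective permutation modules and orders of stabilizers -/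

section Invertibility

/-- A function on a finite group that is invariant under left translation by a subgroup has a sum
divisible by the order of the subgroup. -/
theorem exists_sum_eq_natCard_mul {k : Type*} [Semiring k] {G : Type*} [Group G] [Fintype G]
    (S : Subgroup G) (f : G → k) (hf : ∀ s ∈ S, ∀ g, f (s * g) = f g) :
    ∃ c, ∑ g, f g = Nat.card S * c := by
  classical
  have := Fintype.ofFinite S
  have := Fintype.ofFinite (G ⧸ S)
  -- Inverses of left coset representatives represent the right cosets `S g`, on which `f` is
  -- constant.
  let e : (G ⧸ S) × S → G := fun p => p.2 * p.1.out⁻¹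
  have he : Function.Bijective e := by
    constructor
    · rintro ⟨q, s⟩ ⟨q', s'⟩ h
      have h' : q.out * (s : G)⁻¹ = q'.out * (s' : G)⁻¹ := by
        simpa [e] using congrArg (·⁻¹) h
      have hq : q = q' := by
        rw [← QuotientGroup.out_eq' q, ← QuotientGroup.out_eq' q',
          ← QuotientGroup.mk_mul_of_mem q.out (S.inv_mem s.2), h',
          QuotientGroup.mk_mul_of_mem _ (S.inv_mem s'.2)]
      subst hq
      simpa using h'
    · intro g
      have hm : g * (QuotientGroup.mk g⁻¹ : G ⧸ S).out ∈ S := by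
        simpa using QuotientGroup.eq.1 (QuotientGroup.out_eq' (QuotientGroup.mk g⁻¹ : G ⧸ S)).symm
      exact ⟨⟨QuotientGroup.mk g⁻¹, ⟨_, hm⟩⟩, by simp [e]⟩
  refine ⟨∑ q : G ⧸ S, f q.out⁻¹, ?_⟩
  rw [← he.sum_comp, Fintype.sum_prod_type]
  simp only [e, hf _ (Subtype.prop _), Finset.sum_const, Finset.card_univ, nsmul_eq_mul,
    Finset.mul_sum, Nat.card_eq_fintype_card]

/-- If a permutation module over a finite group is projective, then the order of the stabilizer of
each point is invertible. -/
theorem natCard_ne_zero_of_projective {k : Type*} [Field k] {G X : Type*} [Group G] [Finite G]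
    (ρ : Representation k G (X →₀ k)) [Module.Projective (MonoidAlgebra k G) ρ.asModule] (b : X)
    (S : Subgroup G) (hS : ∀ g ∈ S, ρ g (Finsupp.single b 1) = Finsupp.single b 1)
    (hS' : ∀ g ∈ S, ∀ m : X →₀ k, ρ g m b = m b) : (Nat.card S : k) ≠ 0 := by
  classical
  have := Fintype.ofFinite G
  obtain ⟨s, hs⟩ := (inferInstance : Module.Projective (MonoidAlgebra k G) ρ.asModule).out
  let B : ρ.asModule := ρ.asModuleEquiv.symm (Finsupp.single b 1)
  have hB : ∀ g ∈ S, MonoidAlgebra.single g (1 : k) • B = B := by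
    intro g hg
    have := (ρ.asModuleEquiv_symm_map_rho g (Finsupp.single b 1)).symm
    rwa [hS g hg] at this
  -- `S` fixes `B`, hence its image under the equivariant section `s`.
  have hD : ∀ p, ∀ g ∈ S, ∀ t, (s B p).coeff (g * t) = (s B p).coeff t := by
    intro p g hg t
    conv_lhs => rw [← hB g hg, map_smul, Finsupp.smul_apply, smul_eq_mul]
    rw [MonoidAlgebra.coeff_single_mul_eq_mul_coeff (m₂ := t) (by simp), one_mul]
  -- The coefficient at `b` is a sum over `G` whose terms are invariant under left translation by
  -- `S`, so it is a multiple of the order of `S`.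
  have hc : ∀ p : ρ.asModule, ∃ c : k,
      ρ.asAlgebraHom (s B p) (ρ.asModuleEquiv p) b = Nat.card S * c := by
    intro p
    obtain ⟨c, hc⟩ := exists_sum_eq_natCard_mul S
      (fun g => (s B p).coeff g * ρ g (ρ.asModuleEquiv p) b) (fun g hg t => by
        simp only [hD p g hg t, map_mul, Module.End.mul_apply, hS' g hg])
    refine ⟨c, ?_⟩
    rw [← hc, Representation.asAlgebraHom_def, MonoidAlgebra.lift_apply,
      Finsupp.sum_fintype _ _ (by simp), LinearMap.sum_apply, Finsupp.finsetSum_apply]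
    rfl
  choose c hc using hc
  intro h0
  -- Reading `B = ∑ s(B)_p • p` at `b` gives `1` on one side and a multiple of the order of `S` on
  -- the other.
  have h1 := congrArg (fun m => ρ.asModuleEquiv m b) (hs B)
  simp only [Finsupp.linearCombination_apply, Finsupp.sum, id_eq, map_sum,
    Representation.asModuleEquiv_map_smul, Finsupp.finsetSum_apply, hc, h0, zero_mul,
    Finset.sum_const_zero, B, LinearEquiv.apply_symm_apply, Finsupp.single_eq_same] at h1
  exact zero_ne_one h1

/-- The automorphisms of the target of `β` that fix `β`. -/
def targetStabilizer {C : Type u} [Category.{v} C] {x y : C} (β : x ⟶ y) : Subgroup (Aut y) where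
  carrier := {h | β ≫ h.hom = β}
  one_mem' := Category.comp_id β
  mul_mem' {g h} hg hh := by
    change β ≫ h.hom ≫ g.hom = β
    rw [← Category.assoc, hh, hg]
  inv_mem' {g} hg := by
    change β ≫ g.inv = β
    conv_lhs => rw [← hg, Category.assoc]
    exact (congrArg (β ≫ ·) (Iso.hom_inv_id (g : y ≅ y))).trans (Category.comp_id β)

instance finite_aut {C : Type u} [Category.{v} C] [∀ x y : C, Finite (x ⟶ y)] (x : C) :
    Finite (Aut x) :=
  Finite.of_injective (fun g : Aut x => g.hom) fun _ _ h => Iso.ext h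

theorem IsProjectiveOver.natCard_targetStabilizer_ne_zero {k : Type w} [Field k] {C : Type u}
    [Category.{v} C] [∀ x y : C, Finite (x ⟶ y)] (hproj : IsProjectiveOver k C) {x y : C}
    (β : x ⟶ y) : (Nat.card (targetStabilizer β) : k) ≠ 0 := by
  have := (hproj x y).1
  refine natCard_ne_zero_of_projective (leftRep k x y) β (targetStabilizer β) (fun g hg => ?_)
    (fun g hg m => ?_)
  · change Finsupp.mapDomain _ (Finsupp.single β 1) = _
    rw [Finsupp.mapDomain_single]
    exact congrArg (Finsupp.single · 1) hg
  · have hinj : Function.Injective (fun α : x ⟶ y => α ≫ g.hom) := fun α α' h =>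
      (Iso.cancel_iso_hom_right α α' g).1 h
    have := Finsupp.mapDomain_apply hinj m β
    rwa [show β ≫ g.hom = β from hg] at this

end Invertibility

end FinEI

namespace FinEI

noncomputable section

/-! ### Components and linear maps of modules of functors -/

namespace FunctorModule

variable {k : Type w} [Field k] {C : Type u} [Category.{v} C] (M : C ⥤ ModuleCat.{t} k)

open Classical in
/-- The inclusion of a component into the module of a functor. -/
def single (x : C) : M.obj x →ₗ[k] FunctorModule M :=
  LinearMap.single k (fun x : C => M.obj x) x

theorem single_self_apply {x : C} (m : M.obj x) : single M x m x = m := by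
  classical
  exact Pi.single_eq_same (M := fun x : C => M.obj x) x m

theorem single_injective (x : C) : Function.Injective (single M x) := fun m m' h => by
  rw [← single_self_apply M m, h, single_self_apply]

variable [Fintype C]

theorem of_smul {x y : C} (α : x ⟶ y) (m : FunctorModule M) :
    CategoryAlgebra.of k α • m = single M y (M.map α (m x)) := by
  change actLin M (CategoryAlgebra.of k α) m = _
  rw [actLin_of]
  rfl

theorem of_smul_single {x y : C} (α : x ⟶ y) (m : M.obj x) :
    CategoryAlgebra.of k α • single M x m = single M y (M.map α m) := by
  rw [of_smul, single_self_apply]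

theorem sum_single (m : FunctorModule M) : ∑ x, single M x (m x) = m := by
  classical
  exact Finset.univ_sum_single (M := fun x : C => M.obj x) m

instance : IsScalarTower k (CategoryAlgebra k C) (FunctorModule M) :=
  ⟨fun r a m => by
    change actLin M (r • a) m = r • actLin M a m
    rw [map_smul, LinearMap.smul_apply]⟩

variable {M} in
/-- A `k`-linear map that commutes with the action of all morphisms is linear over the category
algebra. -/
def liftLinear {N : Type*} [AddCommGroup N] [Module k N] [Module (CategoryAlgebra k C) N]
    [IsScalarTower k (CategoryAlgebra k C) N] (f : FunctorModule M →ₗ[k] N)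
    (hf : ∀ {x y : C} (α : x ⟶ y) (m : FunctorModule M),
      f (CategoryAlgebra.of k α • m) = CategoryAlgebra.of k α • f m) :
    FunctorModule M →ₗ[CategoryAlgebra k C] N where
  toFun := f
  map_add' := map_add f
  map_smul' a m := by
    let l : CategoryAlgebra k C →ₗ[k] N :=
      f ∘ₗ (LinearMap.toSpanSingleton (CategoryAlgebra k C) _ m).restrictScalars k
    let r : CategoryAlgebra k C →ₗ[k] N :=
      (LinearMap.toSpanSingleton (CategoryAlgebra k C) _ (f m)).restrictScalars k
    have h : l = r := CategoryAlgebra.hom_ext fun x y α => hf α m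
    exact LinearMap.congr_fun h a

variable {M} in
/-- The linear map induced by a natural transformation. -/
def map {M' : C ⥤ ModuleCat.{t} k} (η : M ⟶ M') :
    FunctorModule M →ₗ[CategoryAlgebra k C] FunctorModule M' :=
  liftLinear (M := M) (N := FunctorModule M')
    { toFun := fun m x => η.app x (m x)
      map_add' := fun m m' => funext fun x => map_add (η.app x).hom (m x) (m' x)
      map_smul' := fun r m => funext fun x => map_smul (η.app x).hom r (m x) } fun {x y} α m => by
    classical
    rw [of_smul, of_smul]
    refine funext fun z => ?_
    change (η.app z).hom (single M y (M.map α (m x)) z) =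
      single M' y (M'.map α ((η.app x).hom (m x))) z
    by_cases h : z = y
    · subst h
      rw [single_self_apply, single_self_apply]
      exact ConcreteCategory.congr_hom (η.naturality α) (m x)
    · have h₁ : single M y (M.map α (m x)) z = 0 :=
        Pi.single_eq_of_ne (M := fun x : C => M.obj x) h _
      have h₂ : single M' y (M'.map α ((η.app x).hom (m x))) z = 0 :=
        Pi.single_eq_of_ne (M := fun x : C => M'.obj x) h _
      rw [h₁, h₂, map_zero]

theorem map_apply {M' : C ⥤ ModuleCat.{t} k} (η : M ⟶ M') (m : FunctorModule M) (x : C) :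
    map η m x = η.app x (m x) := rfl

theorem map_single {M' : C ⥤ ModuleCat.{t} k} (η : M ⟶ M') {x : C} (m : M.obj x) :
    map η (single M x m) = single M' x (η.app x m) := by
  classical
  refine funext fun z => ?_
  rw [map_apply]
  by_cases h : z = x
  · subst h
    rw [single_self_apply, single_self_apply]
  · have h₁ : single M x m z = 0 := Pi.single_eq_of_ne (M := fun x : C => M.obj x) h _
    have h₂ : single M' x (η.app x m) z = 0 := Pi.single_eq_of_ne (M := fun x : C => M'.obj x) h _
    rw [h₁, h₂, map_zero]

end FunctorModule

/-! ### Averaging idempotents -/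

section Projective

variable {k : Type w} [Field k] {C : Type u} [Category.{v} C] [Fintype C]
  [∀ x y : C, Finite (x ⟶ y)]

open CategoryAlgebra

/-- The average over the automorphisms that fix the target of `β`. -/
theorem exists_average {x y : C} (β : x ⟶ y) (hβ : (Nat.card (targetStabilizer β) : k) ≠ 0) :
    ∃ e : CategoryAlgebra k C, (∀ i : y ≅ y, β ≫ i.hom = β → of k i.hom * e = e) ∧
      ∀ (M : C ⥤ ModuleCat.{t} k) (m : M.obj y),
        (∀ h ∈ targetStabilizer β, M.map h.hom m = m) →
        e • FunctorModule.single M y m = FunctorModule.single M y m := by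
  have := Fintype.ofFinite (targetStabilizer β)
  refine ⟨(Nat.card (targetStabilizer β) : k)⁻¹ • ∑ h : targetStabilizer β, of k h.1.hom, ?_, ?_⟩
  · intro i hi
    rw [mul_smul_comm, Finset.mul_sum]
    congr 1
    refine Eq.trans (Finset.sum_congr rfl fun h _ => ?_)
      -- Left multiplication by an element of the stabilizer permutes the summands.
      (Equiv.sum_comp (Equiv.mulLeft (⟨i, hi⟩ : targetStabilizer β)) fun h => of k h.1.hom)
    exact of_mul_of i.hom h.1.hom
  · intro M m hm
    rw [smul_assoc, Finset.sum_smul]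
    have h : ∀ h : targetStabilizer β, of k h.1.hom • FunctorModule.single M y m =
        FunctorModule.single M y m := fun h => by
      rw [FunctorModule.of_smul_single, hm h.1 h.2]
    simp only [h, Finset.sum_const, Finset.card_univ, ← Nat.card_eq_fintype_card]
    rw [← Nat.cast_smul_eq_nsmul k, smul_smul, inv_mul_cancel₀ hβ, one_smul]

end Projective

end

end FinEI

namespace FinEI

noncomputable section

/-! ### Compatible choices of first factors -/

section Free

variable {C : Type u} [Category.{v} C]

/-- The unfactorizable morphisms with a given source. -/
structure UnfactorizableFrom (w : C) where
  {tgt : C}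
  hom : w ⟶ tgt
  unfactorizable : Unfactorizable hom

/-- Unfactorizable morphisms are equivalent if they differ by an isomorphism of their targets. -/
instance UnfactorizableFrom.setoid (w : C) : Setoid (UnfactorizableFrom w) where
  r β β' := ∃ i : β.tgt ≅ β'.tgt, β'.hom = β.hom ≫ i.hom
  iseqv :=
    { refl := fun β => ⟨Iso.refl _, by simp⟩
      symm := fun ⟨i, h⟩ => ⟨i.symm, by simp [h]⟩
      trans := fun ⟨i, h⟩ ⟨j, h'⟩ => ⟨i ≪≫ j, by simp [h, h']⟩ }

/-- The chosen representative of the class of an unfactorizable morphism. -/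
def UnfactorizableFrom.rep {w : C} (β : UnfactorizableFrom w) : UnfactorizableFrom w :=
  (Quotient.mk (UnfactorizableFrom.setoid w) β).out

theorem UnfactorizableFrom.exists_rep_eq {w : C} (β : UnfactorizableFrom w) :
    ∃ i : β.tgt ≅ β.rep.tgt, β.rep.hom = β.hom ≫ i.hom :=
  Setoid.symm (Quotient.mk_out (s := UnfactorizableFrom.setoid w) β)

theorem UnfactorizableFrom.rep_eq_rep {w : C} {β β' : UnfactorizableFrom w}
    (h : ∃ i : β.tgt ≅ β'.tgt, β'.hom = β.hom ≫ i.hom) : β.rep = β'.rep :=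
  congrArg Quotient.out (Quotient.sound (s := UnfactorizableFrom.setoid w) h)

/-- In a category with unique first factors, one can choose an unfactorizable first factor of each
non-isomorphism in a way that is compatible with composition. -/
theorem UniqueFirstFactor.exists_choice [Finite C] (hEI : IsEI C) (hsk : Skeletal C)
    (hC : UniqueFirstFactor C) :
    ∃ r : ∀ {y : C} (γ : KBasis y), UnfactorizableFrom γ.src,
      (∀ {y : C} (γ : KBasis y), ∃ α, (r γ).hom ≫ α = γ.hom) ∧
      ∀ {y z : C} (γ : KBasis y) (δ : y ⟶ z), r (KBasis.comp hEI hsk δ γ) = r γ := by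
  have h : ∀ {y : C} (γ : KBasis y), ∃ (β : UnfactorizableFrom γ.src) (α : β.tgt ⟶ y),
      β.hom ≫ α = γ.hom := fun γ => by
    obtain ⟨z, β, α, hβ, h⟩ := exists_unfactorizable_comp hEI hsk γ.hom
      (fun h => γ.ne ((isIso_iff_eq hEI hsk _).1 h))
    exact ⟨⟨β, hβ⟩, α, h⟩
  choose f a ha using @h
  -- Uniqueness only makes the first factors of `γ` and `δ ∘ γ` equivalent; passing to class
  -- representatives makes them equal.
  refine ⟨fun γ => (f γ).rep, fun γ => ?_, fun γ δ => ?_⟩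
  · obtain ⟨i, hi⟩ := (f γ).exists_rep_eq
    exact ⟨i.inv ≫ a γ, by rw [hi, Category.assoc, Iso.hom_inv_id_assoc, ha]⟩
  · obtain ⟨i, hi, -⟩ := hC (f (KBasis.comp hEI hsk δ γ)).hom (f γ).hom
      (a (KBasis.comp hEI hsk δ γ)) (a γ ≫ δ) (UnfactorizableFrom.unfactorizable _)
      (UnfactorizableFrom.unfactorizable _) (by
        rw [ha]
        change γ.hom ≫ δ = _
        rw [← ha γ]
        exact Category.assoc _ _ _)
    exact UnfactorizableFrom.rep_eq_rep ⟨i, hi⟩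

end Free

/-! ### Uniqueness of first factors implies that `K` is projective -/

section Projective

variable {k : Type w} [Field k] {C : Type u} [Category.{v} C]

open CategoryAlgebra

/-- A basis element of `K(x)`. -/
def vecK (k : Type w) [Field k] (hEI : IsEI C) (hsk : Skeletal C) {x : C} (γ : KBasis x) :
    (functorK k hEI hsk).obj x :=
  (Finsupp.single γ 1 : KBasis x →₀ k)

/-- A basis element of the module of the functor `K`. -/
def basisK (k : Type w) [Field k] (hEI : IsEI C) (hsk : Skeletal C) {x : C} (γ : KBasis x) :
    FunctorModule (functorK k hEI hsk) :=
  FunctorModule.single (functorK k hEI hsk) x (vecK k hEI hsk γ)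

theorem functorK_map_vecK (hEI : IsEI C) (hsk : Skeletal C) {x y : C} (α : x ⟶ y)
    (γ : KBasis x) : (functorK k hEI hsk).map α (vecK k hEI hsk γ) =
      vecK k hEI hsk (KBasis.comp hEI hsk α γ) :=
  Finsupp.mapDomain_single

variable [Fintype C]

theorem of_smul_basisK (hEI : IsEI C) (hsk : Skeletal C) {x y : C} (α : x ⟶ y) (γ : KBasis x) :
    of k α • basisK k hEI hsk γ = basisK k hEI hsk (KBasis.comp hEI hsk α γ) := by
  rw [basisK, FunctorModule.of_smul_single, functorK_map_vecK, basisK]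

/-- A map on the basis elements of `K` that is compatible with the action of morphisms extends to a
linear map over the category algebra. -/
theorem exists_linearMap_functorK (hEI : IsEI C) (hsk : Skeletal C) {N : Type*} [AddCommGroup N]
    [Module k N] [Module (CategoryAlgebra k C) N] [IsScalarTower k (CategoryAlgebra k C) N]
    [SMulCommClass (CategoryAlgebra k C) k N]
    (t : ∀ {x : C}, KBasis x → N)
    (ht : ∀ {x y : C} (α : x ⟶ y) (γ : KBasis x), of k α • t γ = t (KBasis.comp hEI hsk α γ))
    (ht' : ∀ {x y z : C} (α : x ⟶ y) (γ : KBasis z), z ≠ x → of k α • t γ = 0) :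
    ∃ T : FunctorModule (functorK k hEI hsk) →ₗ[CategoryAlgebra k C] N,
      ∀ {x : C} (γ : KBasis x), T (basisK k hEI hsk γ) = t γ := by
  classical
  let l (x : C) : (KBasis x →₀ k) →ₗ[k] N := Finsupp.linearCombination k t
  have hl : ∀ {x y : C} (α : x ⟶ y) (n : KBasis x →₀ k),
      of k α • l x n = l y (Finsupp.lmapDomain k k (KBasis.comp hEI hsk α) n) := by
    intro x y α n
    simp only [l, Finsupp.lmapDomain_apply, Finsupp.linearCombination_mapDomain]
    simp only [Finsupp.linearCombination_apply, Finsupp.sum, Finset.smul_sum]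
    refine Finset.sum_congr rfl fun γ _ => ?_
    rw [smul_comm, ht]
    rfl
  have hl' : ∀ {x y z : C} (α : x ⟶ y) (n : KBasis z →₀ k), z ≠ x → of k α • l z n = 0 := by
    intro x y z α n h
    simp only [l, Finsupp.linearCombination_apply, Finsupp.sum, Finset.smul_sum]
    refine Finset.sum_eq_zero fun γ _ => ?_
    rw [smul_comm, ht' α γ h, smul_zero]
  let f : FunctorModule (functorK k hEI hsk) →ₗ[k] N :=
    { toFun := fun m => ∑ x, l x (m x)
      map_add' := fun m m' => by
        rw [← Finset.sum_add_distrib]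
        exact Finset.sum_congr rfl fun x _ => map_add (l x) (m x) (m' x)
      map_smul' := fun r m => by
        rw [Finset.smul_sum]
        exact Finset.sum_congr rfl fun x _ => map_smul (l x) r (m x) }
  have hf : ∀ {x : C} (n : KBasis x →₀ k),
      f (FunctorModule.single (functorK k hEI hsk) x n) = l x n := by
    intro x n
    refine (Finset.sum_eq_single x (fun z _ hz => ?_) (by simp)).trans ?_
    · have : FunctorModule.single (functorK k hEI hsk) x n z = 0 :=
        Pi.single_eq_of_ne (M := fun x : C => (functorK k hEI hsk).obj x) hz _
      rw [this]
      exact map_zero (l z)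
    · exact congrArg (l x) (FunctorModule.single_self_apply (functorK k hEI hsk) n)
  refine ⟨FunctorModule.liftLinear f fun {x y} α m => ?_, fun {x} γ => ?_⟩
  · rw [FunctorModule.of_smul]
    refine (hf _).trans ((hl α (m x)).symm.trans ?_)
    change _ = of k α • ∑ z, l z (m z)
    rw [Finset.smul_sum]
    exact (Finset.sum_eq_single x (fun z _ hz => hl' α (m z) hz) (by simp)).symm
  · exact (hf _).trans ((Finsupp.linearCombination_single k 1 γ).trans (one_smul k (t γ)))

theorem linearMap_functorK_ext (hEI : IsEI C) (hsk : Skeletal C) {N : Type*} [AddCommGroup N]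
    [Module k N] [Module (CategoryAlgebra k C) N] [IsScalarTower k (CategoryAlgebra k C) N]
    {f g : FunctorModule (functorK k hEI hsk) →ₗ[CategoryAlgebra k C] N}
    (h : ∀ {x : C} (γ : KBasis x), f (basisK k hEI hsk γ) = g (basisK k hEI hsk γ)) : f = g := by
  refine LinearMap.ext fun m => ?_
  rw [← FunctorModule.sum_single _ m, map_sum, map_sum]
  refine Finset.sum_congr rfl fun x _ => ?_
  have : (f.restrictScalars k ∘ₗ FunctorModule.single (functorK k hEI hsk) x :
        (KBasis x →₀ k) →ₗ[k] N) =
      g.restrictScalars k ∘ₗ FunctorModule.single (functorK k hEI hsk) x :=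
    Finsupp.lhom_ext' fun γ => LinearMap.ext_ring (h γ)
  exact LinearMap.congr_fun this (m x)

theorem projective_functorK [∀ x y : C, Finite (x ⟶ y)] (hEI : IsEI C) (hsk : Skeletal C)
    (hproj : IsProjectiveOver k C) (hC : UniqueFirstFactor C) :
    Module.Projective (CategoryAlgebra k C) (FunctorModule (functorK k hEI hsk)) := by
  obtain ⟨r, hr, hr'⟩ := hC.exists_choice hEI hsk
  choose a ha using @hr
  have he := fun {x y : C} (β : x ⟶ y) =>
    exists_average.{w, v, u, max u v w} (k := k) β (hproj.natCard_targetStabilizer_ne_zero β)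
  choose e he he' using @he
  have hne : ∀ {w : C} (β : UnfactorizableFrom w), w ≠ β.tgt := fun β h =>
    β.unfactorizable.1 ((isIso_iff_eq hEI hsk _).2 h)
  let B {w : C} (β : UnfactorizableFrom w) : KBasis β.tgt := ⟨w, hne β, β.hom⟩
  -- Two such cofactors differ by an automorphism fixing `β`, which `e β` absorbs; hence `t` below
  -- does not depend on the choice of `a`.
  have hα : ∀ {x y z : C} (β : x ⟶ y) (α α' : y ⟶ z), Unfactorizable β → β ≫ α = β ≫ α' →
      of k α * e β = of k α' * e β := by
    intro x y z β α α' hβ h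
    obtain ⟨i, hi, rfl⟩ := hC β β α α' hβ hβ h
    rw [← of_mul_of, mul_assoc, he β i hi.symm]
  let t {y : C} (γ : KBasis y) : FunctorModule (functorK k hEI hsk) →₀ CategoryAlgebra k C :=
    Finsupp.single (basisK k hEI hsk (B (r γ))) (of k (a γ) * e (r γ).hom)
  obtain ⟨T, hT⟩ := exists_linearMap_functorK (k := k) hEI hsk t
    (fun {x y} α γ => by
      -- The first factor of the composite equals `r γ` only propositionally, and the type of the
      -- cofactor depends on it; a variable `β` lets this equality be substituted.
      have key : ∀ (β : UnfactorizableFrom γ.src) (α' : β.tgt ⟶ y), β = r γ →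
          β.hom ≫ α' = γ.hom ≫ α → of k α • t γ =
            Finsupp.single (basisK k hEI hsk (B β)) (of k α' * e β.hom) := by
        rintro _ α' rfl h
        rw [Finsupp.smul_single, smul_eq_mul, ← mul_assoc, of_mul_of]
        congr 1
        refine hα _ _ _ (r γ).unfactorizable ?_
        rw [h, ← Category.assoc, ha]
      exact key _ _ (hr' γ α) (ha (KBasis.comp hEI hsk α γ)))
    (fun {x y z} α γ h => by
      rw [Finsupp.smul_single, smul_eq_mul, ← mul_assoc, of_mul_of_ne _ _ h, zero_mul,
        Finsupp.single_zero])
  refine ⟨T, ?_⟩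
  have : Finsupp.linearCombination (CategoryAlgebra k C) id ∘ₗ T = LinearMap.id := by
    refine linearMap_functorK_ext hEI hsk fun {x} γ => ?_
    rw [LinearMap.comp_apply, hT, Finsupp.linearCombination_single, id_eq, mul_smul, basisK,
      he', ← basisK, of_smul_basisK, LinearMap.id_apply]
    · congr 1
      exact congrArg (fun f => (⟨γ.src, _, f⟩ : KBasis x)) (ha γ)
    · intro h hh
      rw [functorK_map_vecK]
      congr 1
      exact congrArg (fun f => (⟨γ.src, _, f⟩ : KBasis (r γ).tgt)) hh
  exact LinearMap.congr_fun this

end Projective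

end

end FinEI

namespace FinEI

noncomputable section

/-! ### Two facts on finitely supported functions -/

section Finsupp

variable {k X Y N : Type*} [Semiring k] [AddCommMonoid N] [Module k N]

theorem linearMap_finsupp_congr {f g : (X →₀ k) →ₗ[k] N} (n : X →₀ k)
    (h : ∀ q, n q ≠ 0 → f (Finsupp.single q 1) = g (Finsupp.single q 1)) : f n = g n := by
  rw [← Finsupp.sum_single n, Finsupp.sum, map_sum, map_sum]
  refine Finset.sum_congr rfl fun q hq => ?_
  rw [← mul_one (n q), ← smul_eq_mul, ← Finsupp.smul_single, map_smul, map_smul,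
    h q (Finsupp.mem_support_iff.1 hq)]

theorem mapDomain_apply_of_unique (κ : X → Y) (n : X →₀ k) (q : X)
    (h : ∀ q', κ q' = κ q → q' = q) : Finsupp.mapDomain κ n (κ q) = n q := by
  classical
  rw [Finsupp.mapDomain, Finsupp.sum_apply, Finsupp.sum]
  refine (Finset.sum_eq_single q (fun q' _ hq' => ?_) (fun hq => ?_)).trans
    Finsupp.single_eq_same
  · rw [Finsupp.single_apply, if_neg fun h' => hq' (h q' h')]
  · rw [Finsupp.notMem_support_iff.1 hq, Finsupp.single_zero, Finsupp.zero_apply]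

end Finsupp

/-! ### The cover `L` of `K`, and the converse -/

variable {C : Type u} [Category.{v} C]

/-- A composite of two morphisms, the first of which is unfactorizable. -/
structure Factored (y : C) where
  {src : C}
  {mid : C}
  left : src ⟶ mid
  unfactorizable : Unfactorizable left
  right : mid ⟶ y

namespace Factored

/-- The equivalence relation `(i ∘ β, α) ∼ (β, α ∘ i)` for isomorphisms `i`. -/
inductive Rel {y : C} : Factored y → Factored y → Prop
  | mk {w x x' : C} (β : w ⟶ x) (β' : w ⟶ x') (hβ : Unfactorizable β) (hβ' : Unfactorizable β')
      (α : x ⟶ y) (α' : x' ⟶ y) (i : x ≅ x') (h : β' = β ≫ i.hom) (h' : α = i.hom ≫ α') :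
      Rel ⟨β, hβ, α⟩ ⟨β', hβ', α'⟩

instance setoid (y : C) : Setoid (Factored y) where
  r := Rel
  iseqv :=
    { refl := fun ⟨β, hβ, α⟩ => .mk β β hβ hβ α α (Iso.refl _) (by simp) (by simp)
      symm := by
        rintro _ _ ⟨β, β', hβ, hβ', α, α', i, h, h'⟩
        exact .mk β' β hβ' hβ α' α i.symm (by simp [h]) (by simp [h'])
      trans := by
        rintro _ _ _ ⟨β, β', hβ, hβ', α, α', i, h, h'⟩ ⟨_, β'', _, hβ'', _, α'', j, g, g'⟩
        exact .mk β β'' hβ hβ'' α α'' (i ≪≫ j) (by simp [h, g]) (by simp [h', g']) }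

end Factored

/-- The classes of composites of two morphisms, the first of which is unfactorizable. -/
abbrev FactoredClass (y : C) : Type max u v := Quotient (Factored.setoid y)

namespace FactoredClass

/-- The class of a pair of composable morphisms. -/
def mk {w x y : C} (β : w ⟶ x) (hβ : Unfactorizable β) (α : x ⟶ y) : FactoredClass y :=
  Quotient.mk _ ⟨β, hβ, α⟩

theorem ind {y : C} {motive : FactoredClass y → Prop}
    (h : ∀ {w x : C} (β : w ⟶ x) (hβ : Unfactorizable β) (α : x ⟶ y), motive (mk β hβ α))
    (q : FactoredClass y) : motive q :=
  Quotient.ind (fun ⟨β, hβ, α⟩ => h β hβ α) q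

theorem mk_eq_mk {w x x' y : C} {β : w ⟶ x} {β' : w ⟶ x'} {hβ : Unfactorizable β}
    {hβ' : Unfactorizable β'} {α : x ⟶ y} {α' : x' ⟶ y} :
    mk β hβ α = mk β' hβ' α' ↔ ∃ i : x ≅ x', β' = β ≫ i.hom ∧ α = i.hom ≫ α' := by
  constructor
  · intro h
    obtain ⟨_, _, _, _, _, _, i, h, h'⟩ := (Quotient.exact h : Factored.Rel _ _)
    exact ⟨i, h, h'⟩
  · rintro ⟨i, h, h'⟩
    exact Quotient.sound (.mk β β' hβ hβ' α α' i h h')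

/-- Composition with a morphism. -/
def comp {y z : C} (δ : y ⟶ z) : FactoredClass y → FactoredClass z :=
  Quotient.lift (fun p => mk p.left p.unfactorizable (p.right ≫ δ)) (by
    rintro _ _ ⟨β, β', hβ, hβ', α, α', i, h, h'⟩
    exact mk_eq_mk.2 ⟨i, h, by rw [h', Category.assoc]⟩)

theorem comp_mk {w x y z : C} (β : w ⟶ x) (hβ : Unfactorizable β) (α : x ⟶ y) (δ : y ⟶ z) :
    comp δ (mk β hβ α) = mk β hβ (α ≫ δ) := rfl

/-- The composite of a pair of morphisms, as a basis element of `K`. -/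
def toKBasis (hEI : IsEI C) (hsk : Skeletal C) {y : C} : FactoredClass y → KBasis y :=
  Quotient.lift (fun p => ⟨p.src, ne_of_comp hEI hsk
      (fun h => p.unfactorizable.1 ((isIso_iff_eq hEI hsk _).2 h)) p.left p.right,
      p.left ≫ p.right⟩) (by
    rintro _ _ ⟨β, β', hβ, hβ', α, α', i, rfl, rfl⟩
    simp)

theorem toKBasis_mk_eq_iff (hEI : IsEI C) (hsk : Skeletal C) {w x x' y : C} {β : w ⟶ x}
    {β' : w ⟶ x'} {hβ : Unfactorizable β} {hβ' : Unfactorizable β'} {α : x ⟶ y} {α' : x' ⟶ y} :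
    toKBasis hEI hsk (mk β hβ α) = toKBasis hEI hsk (mk β' hβ' α') ↔ β ≫ α = β' ≫ α' := by
  change KBasis.mk _ _ _ = KBasis.mk _ _ _ ↔ _
  simp

theorem toKBasis_comp (hEI : IsEI C) (hsk : Skeletal C) {y z : C} (δ : y ⟶ z)
    (q : FactoredClass y) :
    toKBasis hEI hsk (comp δ q) = KBasis.comp hEI hsk δ (toKBasis hEI hsk q) := by
  induction q using ind with
  | h β hβ α => exact congrArg (KBasis.mk _ _) (Category.assoc β α δ).symm

theorem toKBasis_surjective [Finite C] (hEI : IsEI C) (hsk : Skeletal C) (y : C) :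
    Function.Surjective (toKBasis hEI hsk : FactoredClass y → KBasis y) := by
  rintro ⟨w, hne, γ⟩
  obtain ⟨z, β, α, hβ, rfl⟩ := exists_unfactorizable_comp hEI hsk γ
    (fun h => hne ((isIso_iff_eq hEI hsk _).1 h))
  exact ⟨mk β hβ α, rfl⟩

/-- A composite `α ∘ β` with `β` unfactorizable and `α` an isomorphism determines its class. -/
theorem eq_of_toKBasis_eq (hEI : IsEI C) (hsk : Skeletal C) {w x y : C} {β : w ⟶ x}
    {hβ : Unfactorizable β} {α : x ⟶ y} [IsIso α] (q : FactoredClass y)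
    (h : toKBasis hEI hsk q = toKBasis hEI hsk (mk β hβ α)) : q = mk β hβ α := by
  induction q using ind with
  | @h w' x' β' hβ' α' =>
    obtain rfl : w' = w := congrArg KBasis.src h
    rw [toKBasis_mk_eq_iff] at h
    have : IsIso α' := ((hβ.comp_iso α).2 x' β' α' h).resolve_left hβ'.1
    refine mk_eq_mk.2 ⟨asIso α' ≪≫ (asIso α).symm, ?_, by simp⟩
    simp [← Category.assoc, h]

end FactoredClass

variable (k : Type w) [Field k]

/-- The functor `L`, where `L(y)` has as basis the pairs `(β, α)` of composable morphisms with
`β` unfactorizable and `α` ending in `y`, up to isomorphisms of the intermediate object. -/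
def functorL (C : Type u) [Category.{v} C] : C ⥤ ModuleCat.{max u v w} k where
  obj y := ModuleCat.of k (FactoredClass y →₀ k)
  map δ := ModuleCat.ofHom (Finsupp.lmapDomain k k (FactoredClass.comp δ))
  map_id x := by
    have h : FactoredClass.comp (𝟙 x) = id := by
      funext q
      induction q using FactoredClass.ind with
      | h β hβ α => simp [FactoredClass.comp_mk]
    rw [h, Finsupp.lmapDomain_id]
    rfl
  map_comp {x y z} δ ε := by
    have h : FactoredClass.comp (δ ≫ ε) = FactoredClass.comp ε ∘ FactoredClass.comp δ := by
      funext q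
      induction q using FactoredClass.ind with
      | h β hβ α => simp [FactoredClass.comp_mk]
    rw [h, Finsupp.lmapDomain_comp]
    rfl

/-- The natural transformation `L ⟶ K` given by composition. -/
def composition (hEI : IsEI C) (hsk : Skeletal C) : functorL k C ⟶ functorK k hEI hsk where
  app y := ModuleCat.ofHom (Finsupp.lmapDomain k k (FactoredClass.toKBasis hEI hsk))
  naturality {y z} δ := by
    have h : FactoredClass.toKBasis hEI hsk ∘ FactoredClass.comp δ =
        KBasis.comp hEI hsk δ ∘ FactoredClass.toKBasis hEI hsk :=
      funext (FactoredClass.toKBasis_comp hEI hsk δ)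
    have h' := congrArg (Finsupp.lmapDomain k k) h
    rw [Finsupp.lmapDomain_comp, Finsupp.lmapDomain_comp] at h'
    exact ModuleCat.hom_ext h'

/-- A basis element of `L(y)`. -/
def vecL {y : C} (q : FactoredClass y) : (functorL k C).obj y :=
  (Finsupp.single q 1 : FactoredClass y →₀ k)

/-- A basis element of the module of the functor `L`. -/
def basisL {y : C} (q : FactoredClass y) : FunctorModule (functorL k C) :=
  FunctorModule.single (functorL k C) y (vecL k q)

theorem basisL_injective {y : C} : Function.Injective (basisL k (y := y)) := fun _ _ h =>
  Finsupp.single_left_injective (one_ne_zero (α := k)) (FunctorModule.single_injective _ _ h)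

theorem composition_app_vecL (hEI : IsEI C) (hsk : Skeletal C) {y : C} (q : FactoredClass y) :
    (composition k hEI hsk).app y (vecL k q) = vecK k hEI hsk (FactoredClass.toKBasis hEI hsk q) :=
  Finsupp.mapDomain_single

theorem functorL_map_vecL {y z : C} (δ : y ⟶ z) (q : FactoredClass y) :
    (functorL k C).map δ (vecL k q) = vecL k (FactoredClass.comp δ q) :=
  Finsupp.mapDomain_single

variable [Fintype C]

theorem of_smul_basisL {y z : C} (δ : y ⟶ z) (q : FactoredClass y) :
    CategoryAlgebra.of k δ • basisL k q = basisL k (FactoredClass.comp δ q) := by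
  rw [basisL, FunctorModule.of_smul_single, functorL_map_vecL, basisL]

theorem map_composition_basisL (hEI : IsEI C) (hsk : Skeletal C) {y : C} (q : FactoredClass y) :
    FunctorModule.map (composition k hEI hsk) (basisL k q) =
      basisK k hEI hsk (FactoredClass.toKBasis hEI hsk q) := by
  rw [basisL, FunctorModule.map_single, composition_app_vecL, basisK]

theorem map_composition_surjective (hEI : IsEI C) (hsk : Skeletal C) :
    Function.Surjective (FunctorModule.map (composition k hEI hsk)) := by
  intro m
  have h : ∀ y, Function.Surjective (Finsupp.lmapDomain k k
      (FactoredClass.toKBasis hEI hsk : FactoredClass y → KBasis y)) := fun y =>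
    Finsupp.mapDomain_surjective (FactoredClass.toKBasis_surjective hEI hsk y)
  choose n hn using fun y => h y (m y)
  exact ⟨n, funext hn⟩

/-- A section of the module map `L ⟶ K` is a two-sided inverse. -/
theorem section_map_composition_basisL (hEI : IsEI C) (hsk : Skeletal C)
    (s : FunctorModule (functorK k hEI hsk) →ₗ[CategoryAlgebra k C] FunctorModule (functorL k C))
    (hs : ∀ m, FunctorModule.map (composition k hEI hsk) (s m) = m) {w x : C} (β : w ⟶ x)
    (hβ : Unfactorizable β) {y : C} (α : x ⟶ y) :
    s (FunctorModule.map (composition k hEI hsk) (basisL k (.mk β hβ α))) =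
      basisL k (.mk β hβ α) := by
  induction x using (wellFounded_precedes hEI hsk).induction generalizing w y with
  | _ x ih =>
    set P := FunctorModule.map (composition k hEI hsk)
    set g := basisL k (FactoredClass.mk β hβ (𝟙 x)) with hg
    -- The class of `(β, α)` is `α` applied to that of `(β, 1)`, and both maps are linear over the
    -- category algebra.
    suffices h : s (P g) = g by
      have h' : basisL k (FactoredClass.mk β hβ α) = CategoryAlgebra.of k α • g := by
        rw [hg, of_smul_basisL, FactoredClass.comp_mk, Category.id_comp]
      rw [h', map_smul, map_smul, h]
    have hg₁ : CategoryAlgebra.of k (𝟙 x) • g = g := by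
      rw [hg, of_smul_basisL, FactoredClass.comp_mk, Category.id_comp]
    -- The difference is fixed by the identity of `x`, so it lives in the component at `x`.
    have hu : FunctorModule.single (functorL k C) x ((g - s (P g)) x) = g - s (P g) := by
      have : CategoryAlgebra.of k (𝟙 x) • (g - s (P g)) = g - s (P g) := by
        rw [smul_sub, ← map_smul, ← map_smul, hg₁]
      rw [FunctorModule.of_smul, (functorL k C).map_id] at this
      exact this
    have hPu : P (g - s (P g)) = 0 := by rw [map_sub, hs, sub_self]
    refine (sub_eq_zero.1 ?_).symm
    generalize g - s (P g) = d at hu hPu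
    have hn : Finsupp.mapDomain (FactoredClass.toKBasis hEI hsk) (d x : FactoredClass x →₀ k) = 0 :=
      congrFun hPu x
    -- A class `(β', α')` with `α'` invertible is the only one with its composite, so its
    -- coefficient in `d` is one of `P d = 0`. The classes left in `d` have intermediate object
    -- preceding `x`; by induction `s ∘ P` fixes them, hence `d`, so `d = s (P d) = 0`.
    have key : ((s ∘ₗ P).restrictScalars k ∘ₗ FunctorModule.single (functorL k C) x :
          (FactoredClass x →₀ k) →ₗ[k] FunctorModule (functorL k C)) (d x) =
        (FunctorModule.single (functorL k C) x :
          (FactoredClass x →₀ k) →ₗ[k] FunctorModule (functorL k C)) (d x) := by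
      refine linearMap_finsupp_congr (d x : FactoredClass x →₀ k) fun q hq => ?_
      induction q using FactoredClass.ind with
      | @h w' x' β' hβ' α' =>
        refine ih x' (.of_not_isIso hEI hsk fun hα' : IsIso α' => hq ?_) β' hβ' α'
        rw [← mapDomain_apply_of_unique (FactoredClass.toKBasis hEI hsk)
          (d x : FactoredClass x →₀ k) _ (FactoredClass.eq_of_toKBasis_eq hEI hsk), hn]
        rfl
    rw [← hu]
    refine key.symm.trans ((congrArg (fun m => s (P m)) hu).trans ?_)
    change s (P d) = 0
    rw [hPu, map_zero]

theorem uniqueFirstFactor_of_projective (hEI : IsEI C) (hsk : Skeletal C)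
    [Module.Projective (CategoryAlgebra k C) (FunctorModule (functorK k hEI hsk))] :
    UniqueFirstFactor C := by
  obtain ⟨s, hs⟩ := Module.projective_lifting_property
    (FunctorModule.map (composition k hEI hsk)) LinearMap.id (map_composition_surjective k hEI hsk)
  intro w x x' y β β' α α' hβ hβ' h
  refine (FactoredClass.mk_eq_mk (hβ := hβ) (hβ' := hβ')).1 (basisL_injective k ?_)
  rw [← section_map_composition_basisL k hEI hsk s (LinearMap.congr_fun hs) β hβ α,
    ← section_map_composition_basisL k hEI hsk s (LinearMap.congr_fun hs) β' hβ' α',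
    map_composition_basisL, map_composition_basisL, (FactoredClass.toKBasis_mk_eq_iff hEI hsk).2 h]

end

end FinEI

theorem mainTheorem4 {k : Type w} [Field k] {C : Type u} [Category.{v} C]
    [Fintype C] [∀ x y : C, Finite (x ⟶ y)]
    (hEI : FinEI.IsEI C) (hsk : Skeletal C) (hproj : FinEI.IsProjectiveOver k C) :
    Module.Projective (FinEI.CategoryAlgebra k C)
        (FinEI.FunctorModule (FinEI.functorK k hEI hsk)) ↔
      FinEI.IsFree C := by
  rw [FinEI.isFree_iff_uniqueFirstFactor hEI hsk]
  exact ⟨fun _ => FinEI.uniqueFirstFactor_of_projective k hEI hsk,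
    FinEI.projective_functorK hEI hsk hproj⟩
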